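/- Throughout, an ordinal is a type (set) $\alpha$ with a relation $<$ that is transitive, extensional (elements with the same predecessors are equal) and wellfounded (every element is accessible); trichotomy is not assumed. For $a\in\alpha$, the initial segment $\alpha\downarrow a$ is $\{x\in\alpha\mid x<a\}$ with the inherited order. Equality $\alpha=\beta$ of ordinals means that there is an ordinal equivalence, i.e. a bijection $\alpha\to\beta$ that preserves the order and whose inverse preserves the order (in the univalent setting, this is the identity type), and $\alpha<\beta$ means $\alpha=\beta\downarrow b$ for some $b\in\beta$. The product $\alpha\times\beta$ is the cartesian product with $(a',b')<(a,b)$ iff $b'<b$, or $b'=b$ and $a'<a$. The supremum $\sup_{i\in I}F_i$ of a family of ordinals is the quotient of $\sum_{i\in I}F_i$ that identifies $(i,x)$ with $(j,y)$ iff $F_i\downarrow x=F_j\downarrow y$, with $[i,x]<[j,y]$ iff $F_i\downarrow x<F_j\downarrow y$. The abstract exponential is defined by transfinite recursion on $\beta$ by $$\alpha^\beta := \sup_{\mathbf 1+\beta}\bigl(\mathrm{inl}\,\star\mapsto\mathbf 1;\ \mathrm{inr}\,b\mapsto\alpha^{\beta\downarrow b}\times\alpha\bigr).$$ A trichotomous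 least element of $\alpha$ is a least element $\bot$ such that every $x\in\alpha$ satisfies $x=\bot$ or $\bot<x$. In that case $\alpha_{>\bot}=\{a\in\alpha\mid a>\bot\}$, with the inherited order, is an ordinal, and the concrete exponential $\exp(\alpha,\beta)$ is the ordinal of those finite lists over $\alpha_{>\bot}\times\beta$ whose $\beta$-components are strictly decreasing, ordered lexicographically (with respect to the order of the product $\alpha_{>\bot}\times\beta$). **Theorem.** For all ordinals $\alpha$ and $\beta$ such that $\alpha$ has a trichotomous least element, $\alpha^\beta=\exp(\alpha,\beta)$. -/

import Mathlib

universe u v w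

/-- An ordinal: a type with a transitive, extensional and (inductively) wellfounded relation.
Trichotomy is not part of the definition. -/
structure ExtOrd : Type (u + 1) where
  carrier : Type u
  lt : carrier → carrier → Prop
  trans : ∀ {x y z : carrier}, lt x y → lt y z → lt x z
  ext : ∀ {x y : carrier}, (∀ z, lt z x ↔ lt z y) → x = y
  wf : WellFounded lt

namespace ExtOrd

theorem lt_irrefl (α : ExtOrd.{u}) (a : α.carrier) : ¬ α.lt a a :=
  α.wf.induction (C := fun a => ¬ α.lt a a) a fun x ih h => ih x h h

/-- The initial segment `α ↓ a`, with underlying type `{x // x < a}` and the inherited order. -/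
def init (α : ExtOrd.{u}) (a : α.carrier) : ExtOrd.{u} where
  carrier := {x : α.carrier // α.lt x a}
  lt := fun x y => α.lt x.1 y.1
  trans := fun h₁ h₂ => α.trans h₁ h₂
  ext := by
    intro x y h
    apply Subtype.ext
    apply α.ext
    intro z
    exact ⟨fun hz => (h ⟨z, α.trans hz x.2⟩).1 hz, fun hz => (h ⟨z, α.trans hz y.2⟩).2 hz⟩
  wf := InvImage.wf Subtype.val α.wf

/-- `α` and `β` are equivalent as ordinals: there is an equivalence of underlying types which
preserves the order and whose inverse preserves the order. -/
def Equivalent (α : ExtOrd.{u}) (β : ExtOrd.{v}) : Prop := Nonempty (α.lt ≃r β.lt)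

/-- The strict order on ordinals: `α < β` if `α` is equivalent to an initial segment of `β`. -/
def Below (α : ExtOrd.{u}) (β : ExtOrd.{v}) : Prop := ∃ b : β.carrier, Equivalent α (β.init b)

/-! ### Facts about initial segments that the constructions below need -/

theorem Equivalent.refl (α : ExtOrd.{u}) : Equivalent α α := ⟨RelIso.refl _⟩

theorem Equivalent.symm {α : ExtOrd.{u}} {β : ExtOrd.{v}} (h : Equivalent α β) :
    Equivalent β α := h.map RelIso.symm

theorem Equivalent.trans {α : ExtOrd.{u}} {β : ExtOrd.{v}} {γ : ExtOrd.{w}}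
    (h₁ : Equivalent α β) (h₂ : Equivalent β γ) : Equivalent α γ :=
  let ⟨e₁⟩ := h₁
  let ⟨e₂⟩ := h₂
  ⟨e₁.trans e₂⟩

theorem equivalent_init {α : ExtOrd.{u}} {β : ExtOrd.{v}} (e : α.lt ≃r β.lt) (a : α.carrier) :
    Equivalent (α.init a) (β.init (e a)) :=
  ⟨{ toFun := fun x => ⟨e x.1, e.map_rel_iff.2 x.2⟩
     invFun := fun y => ⟨e.symm y.1, by
       have h := y.2
       rw [← e.apply_symm_apply y.1] at h
       exact e.map_rel_iff.1 h⟩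
     left_inv := fun x => Subtype.ext (e.symm_apply_apply x.1)
     right_inv := fun y => Subtype.ext (e.apply_symm_apply y.1)
     map_rel_iff' := fun {x y} => e.map_rel_iff (a := x.1) (b := y.1) }⟩

theorem init_init (α : ExtOrd.{u}) (a : α.carrier) (x : (α.init a).carrier) :
    Equivalent ((α.init a).init x) (α.init x.1) :=
  ⟨{ toFun := fun y => ⟨y.1.1, y.2⟩
     invFun := fun y => ⟨⟨y.1, α.trans y.2 x.2⟩, y.2⟩
     left_inv := fun _ => rfl
     right_inv := fun _ => rfl
     map_rel_iff' := Iff.rfl }⟩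

theorem init_injective (α : ExtOrd.{u}) (a : α.carrier) :
    ∀ b, Equivalent (α.init a) (α.init b) → a = b := by
  have key : ∀ {a b : α.carrier}, Equivalent (α.init a) (α.init b) → ∀ z, α.lt z a →
      ∃ z', α.lt z' b ∧ Equivalent (α.init z) (α.init z') := by
    rintro a b ⟨e⟩ z hz
    exact ⟨(e ⟨z, hz⟩).1, (e ⟨z, hz⟩).2,
      ((init_init α a ⟨z, hz⟩).symm.trans (equivalent_init e ⟨z, hz⟩)).trans (init_init α b _)⟩
  induction a using α.wf.induction with
  | _ a ih =>
    intro b h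
    apply α.ext
    intro z
    constructor
    · intro hz
      obtain ⟨z', hz', h'⟩ := key h z hz
      rwa [ih z hz z' h']
    · intro hz
      obtain ⟨z', hz', h'⟩ := key h.symm z hz
      rwa [← ih z' hz' z h'.symm]

theorem Below.congr_left {α : ExtOrd.{u}} {α' : ExtOrd.{v}} {β : ExtOrd.{w}}
    (h : Equivalent α' α) (hb : Below α β) : Below α' β :=
  let ⟨b, h'⟩ := hb
  ⟨b, h.trans h'⟩

theorem Below.congr_right {α : ExtOrd.{u}} {β : ExtOrd.{v}} {β' : ExtOrd.{w}}
    (h : Equivalent β β') (hb : Below α β) : Below α β' :=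
  let ⟨e⟩ := h
  let ⟨b, h'⟩ := hb
  ⟨e b, h'.trans (equivalent_init e b)⟩

theorem init_below (α : ExtOrd.{u}) (a : α.carrier) : Below (α.init a) α :=
  ⟨a, Equivalent.refl _⟩

theorem init_below_init (α : ExtOrd.{u}) {a b : α.carrier} (h : α.lt a b) :
    Below (α.init a) (α.init b) := ⟨⟨a, h⟩, (init_init α b ⟨a, h⟩).symm⟩

theorem below_init {α : ExtOrd.{u}} {β : ExtOrd.{v}} {b : β.carrier} (h : Below α (β.init b)) :
    ∃ c, β.lt c b ∧ Equivalent α (β.init c) :=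
  let ⟨c, hc⟩ := h
  ⟨c.1, c.2, hc.trans (init_init β b c)⟩

theorem Below.trans {α : ExtOrd.{u}} {β : ExtOrd.{v}} {γ : ExtOrd.{w}}
    (h₁ : Below α β) (h₂ : Below β γ) : Below α γ := by
  obtain ⟨c, hc⟩ := h₂
  obtain ⟨d, -, hd⟩ := below_init (h₁.congr_right hc)
  exact ⟨d, hd⟩

/-- The strict order on ordinals is wellfounded. -/
theorem below_wf : WellFounded (Below : ExtOrd.{u} → ExtOrd.{u} → Prop) := by
  have key : ∀ (α : ExtOrd.{u}) (a : α.carrier) (β : ExtOrd.{u}),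
      Equivalent β (α.init a) → Acc Below β := by
    intro α a
    induction a using α.wf.induction with
    | _ a ih =>
      intro β h
      refine ⟨β, fun γ hγ => ?_⟩
      obtain ⟨c, hc, hγc⟩ := below_init (hγ.congr_right h)
      exact ih c hc γ hγc
  exact ⟨fun α => ⟨α, fun β ⟨a, h⟩ => key α a β h⟩⟩

/-- The strict order on ordinals is extensional, up to equivalence. -/
theorem equivalent_of_init_below {α : ExtOrd.{u}} {β : ExtOrd.{v}}
    (h₁ : ∀ a, Below (α.init a) β) (h₂ : ∀ b, Below (β.init b) α) : Equivalent α β := by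
  choose f hf using h₁
  choose g hg using h₂
  have hfg : ∀ b, f (g b) = b := fun b =>
    (init_injective β b _ ((hg b).trans (hf (g b)))).symm
  have hgf : ∀ a, g (f a) = a := fun a =>
    (init_injective α a _ ((hf a).trans (hg (f a)))).symm
  have hfm : ∀ x y, α.lt x y → β.lt (f x) (f y) := by
    intro x y h
    obtain ⟨c, hc, h'⟩ := below_init ((init_below_init α h).congr_right (hf y))
    rwa [init_injective β (f x) c ((hf x).symm.trans h')]
  have hgm : ∀ x y, β.lt x y → α.lt (g x) (g y) := by
    intro x y h
    obtain ⟨c, hc, h'⟩ := below_init ((init_below_init β h).congr_right (hg y))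
    rwa [init_injective α (g x) c ((hg x).symm.trans h')]
  exact ⟨{ toFun := f, invFun := g, left_inv := hgf, right_inv := hfg
           map_rel_iff' := fun {x y} => ⟨fun h => by
             have := hgm _ _ h
             change α.lt (g (f x)) (g (f y)) at this
             rwa [hgf, hgf] at this, hfm x y⟩ }⟩

/-! ### The ordinal one, products and suprema -/

/-- The ordinal `1`. -/
def one : ExtOrd.{u} where
  carrier := PUnit
  lt := fun _ _ => False
  trans := fun h _ => h
  ext := fun _ => rfl
  wf := ⟨fun x => ⟨x, fun _ h => h.elim⟩⟩

/-- The product `α × β`: the cartesian product with the reverse lexicographic order (the second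
component is dominant). -/
def prod (α : ExtOrd.{u}) (β : ExtOrd.{v}) : ExtOrd.{max u v} where
  carrier := α.carrier × β.carrier
  lt := fun p q => β.lt p.2 q.2 ∨ (p.2 = q.2 ∧ α.lt p.1 q.1)
  trans := by
    rintro ⟨a, b⟩ ⟨a', b'⟩ ⟨a'', b''⟩ h₁ h₂
    dsimp only at h₁ h₂ ⊢
    rcases h₁ with h₁ | ⟨rfl, h₁⟩ <;> rcases h₂ with h₂ | ⟨rfl, h₂⟩
    · exact Or.inl (β.trans h₁ h₂)
    · exact Or.inl h₁
    · exact Or.inl h₂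
    · exact Or.inr ⟨rfl, α.trans h₁ h₂⟩
  ext := by
    have irr : ∀ p : α.carrier × β.carrier, ¬ (β.lt p.2 p.2 ∨ (p.2 = p.2 ∧ α.lt p.1 p.1)) :=
      fun p h => h.elim (β.lt_irrefl _) (fun h => α.lt_irrefl _ h.2)
    have key : ∀ (p q : α.carrier × β.carrier),
        (∀ z : α.carrier × β.carrier, (β.lt z.2 p.2 ∨ (z.2 = p.2 ∧ α.lt z.1 p.1)) ↔
          (β.lt z.2 q.2 ∨ (z.2 = q.2 ∧ α.lt z.1 q.1))) →
        ∀ c, β.lt c p.2 → β.lt c q.2 := by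
      intro p q h c hc
      rcases (h (p.1, c)).1 (Or.inl hc) with h' | ⟨h', -⟩
      · exact h'
      · dsimp only at h'
        subst h'
        exact (irr q ((h q).1 (Or.inl hc))).elim
    intro p q h
    have h2 : p.2 = q.2 := β.ext fun c => ⟨key p q h c, key q p (fun z => (h z).symm) c⟩
    have h1 : p.1 = q.1 := by
      apply α.ext
      intro z
      constructor
      · intro hz
        rcases (h (z, p.2)).1 (Or.inr ⟨rfl, hz⟩) with h' | ⟨-, h'⟩
        · rw [h2] at h'
          exact (β.lt_irrefl _ h').elim
        · exact h'
      · intro hz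
        rcases (h (z, q.2)).2 (Or.inr ⟨rfl, hz⟩) with h' | ⟨-, h'⟩
        · rw [h2] at h'
          exact (β.lt_irrefl _ h').elim
        · exact h'
    exact Prod.ext h1 h2
  wf := by
    refine ⟨fun ⟨a, b⟩ => ?_⟩
    induction b using β.wf.induction generalizing a with
    | _ b ihb =>
      induction a using α.wf.induction with
      | _ a iha =>
        refine ⟨_, ?_⟩
        rintro ⟨a', b'⟩ (h | ⟨h, h'⟩)
        · exact ihb b' h a'
        · dsimp only at h h'
          subst h
          exact iha a' h'

/-- Identification of elements in the supremum of a family: `(i, x) ~ (j, y)` if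
`F i ↓ x` and `F j ↓ y` are equivalent. -/
def supSetoid {I : Type v} (F : I → ExtOrd.{u}) : Setoid (Σ i, (F i).carrier) where
  r := fun p q => Equivalent ((F p.1).init p.2) ((F q.1).init q.2)
  iseqv := ⟨fun _ => Equivalent.refl _, fun h => h.symm, fun h₁ h₂ => h₁.trans h₂⟩

/-- The order on the supremum: `[i, x] < [j, y]` if `F i ↓ x < F j ↓ y`. -/
def supLt {I : Type v} (F : I → ExtOrd.{u}) (x y : Quotient (supSetoid F)) : Prop :=
  Quotient.liftOn₂ x y (fun p q => Below ((F p.1).init p.2) ((F q.1).init q.2))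
    fun _ _ _ _ h₁ h₂ => propext
      ⟨fun h => (h.congr_left (Equivalent.symm h₁)).congr_right h₂,
        fun h => (h.congr_left h₁).congr_right (Equivalent.symm h₂)⟩

/-- The supremum of a family of ordinals, as a quotient of the total space of the family. -/
def sup {I : Type v} (F : I → ExtOrd.{u}) : ExtOrd.{max v u} where
  carrier := Quotient (supSetoid F)
  lt := supLt F
  trans := by
    rintro ⟨p⟩ ⟨q⟩ ⟨r⟩ h₁ h₂
    exact Below.trans h₁ h₂
  ext := by
    rintro ⟨p⟩ ⟨q⟩ h
    apply Quotient.sound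
    change Equivalent ((F p.1).init p.2) ((F q.1).init q.2)
    apply equivalent_of_init_below
    · intro a
      have := (h (Quotient.mk _ ⟨p.1, a.1⟩)).1 (init_below_init _ a.2)
      exact Below.congr_left (init_init _ _ a) this
    · intro a
      have := (h (Quotient.mk _ ⟨q.1, a.1⟩)).2 (init_below_init _ a.2)
      exact Below.congr_left (init_init _ _ a) this
  wf := by
    have key : ∀ (α : ExtOrd.{u}) (p : Σ i, (F i).carrier), α = (F p.1).init p.2 →
        Acc (supLt F) (Quotient.mk _ p) := by
      intro α
      induction α using below_wf.induction with
      | _ α ih =>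
        rintro p rfl
        refine ⟨_, ?_⟩
        rintro ⟨q⟩ h
        exact ih _ h q rfl
    exact ⟨by rintro ⟨p⟩; exact key _ p rfl⟩

/-! ### Abstract exponentiation -/

/-- Abstract exponentiation, by transfinite recursion on the exponent: `α ^ β` is the supremum of
the family indexed by `1 + β` with `inl ⋆ ↦ 1` and `inr b ↦ α ^ (β ↓ b) × α`. -/
noncomputable def abstractExp (α : ExtOrd.{u}) : ExtOrd.{v} → ExtOrd.{max u v} :=
  below_wf.fix fun β rec =>
    sup (I := PUnit.{v + 1} ⊕ β.carrier)
      (Sum.elim (fun _ => one) (fun b => prod (rec (β.init b) (init_below β b)) α))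

/-- The defining recursive equation of abstract exponentiation. -/
theorem abstractExp_eq (α : ExtOrd.{u}) (β : ExtOrd.{v}) :
    abstractExp.{u, v} α β = sup (I := PUnit.{v + 1} ⊕ β.carrier)
      (Sum.elim (fun _ => one) (fun b => prod (abstractExp.{u, v} α (β.init b)) α)) :=
  below_wf.fix_eq _ β

/-! ### Decreasing lists and concrete exponentiation -/

/-- The type of lists over `α × β` that are (strictly) decreasing in the second component. -/
abbrev DecrList (α : ExtOrd.{u}) (β : ExtOrd.{v}) : Type (max u v) :=
  {l : List (α.carrier × β.carrier) // (l.map Prod.snd).Pairwise fun b c => β.lt c b}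

/-- The lexicographic order on decreasing lists, induced by the order of the product `α × β`. -/
def DecrList.lt (α : ExtOrd.{u}) (β : ExtOrd.{v}) (l m : DecrList α β) : Prop :=
  List.Lex (prod α β).lt l.1 m.1

theorem lex_cons_iff (α : ExtOrd.{u}) {a b : α.carrier} {l m : List α.carrier} :
    List.Lex α.lt (a :: l) (b :: m) ↔ α.lt a b ∨ (a = b ∧ List.Lex α.lt l m) := by
  constructor
  · intro h
    cases h with
    | rel h => exact Or.inl h
    | cons h => exact Or.inr ⟨rfl, h⟩
  · rintro (h | ⟨rfl, h⟩)
    · exact List.Lex.rel h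
    · exact List.Lex.cons h

theorem not_lex_nil (α : ExtOrd.{u}) (l : List α.carrier) : ¬ List.Lex α.lt l [] :=
  fun h => nomatch h

theorem lex_irrefl (α : ExtOrd.{u}) (l : List α.carrier) : ¬ List.Lex α.lt l l := by
  induction l with
  | nil => exact fun h => nomatch h
  | cons a l ih =>
    rw [lex_cons_iff]
    rintro (h | ⟨-, h⟩)
    · exact α.lt_irrefl a h
    · exact ih h

theorem lex_trans (α : ExtOrd.{u}) : ∀ {l m n : List α.carrier},
    List.Lex α.lt l m → List.Lex α.lt m n → List.Lex α.lt l n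
  | _, _, [], _, h => nomatch h
  | [], _, _ :: _, _, _ => List.Lex.nil
  | _ :: _, [], _ :: _, h, _ => nomatch h
  | a :: l, b :: m, c :: n, h₁, h₂ => by
    rw [lex_cons_iff] at *
    rcases h₁ with h₁ | ⟨rfl, h₁⟩ <;> rcases h₂ with h₂ | ⟨rfl, h₂⟩
    · exact Or.inl (α.trans h₁ h₂)
    · exact Or.inl h₁
    · exact Or.inl h₂
    · exact Or.inr ⟨rfl, lex_trans α h₁ h₂⟩

theorem decr_cons_of_lex {α : ExtOrd.{u}} {β : ExtOrd.{v}} {p : α.carrier × β.carrier}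
    {l m : List (α.carrier × β.carrier)}
    (hp : ((p :: m).map Prod.snd).Pairwise fun b c => β.lt c b)
    (hl : (l.map Prod.snd).Pairwise fun b c => β.lt c b)
    (h : List.Lex (prod α β).lt l m) :
    ((p :: l).map Prod.snd).Pairwise fun b c => β.lt c b := by
  match l, m, h with
  | [], _, _ => simp
  | _ :: _, [], h => exact nomatch h
  | r :: l, s :: m, h =>
    have hs : β.lt s.2 p.2 := (List.pairwise_cons.1 hp).1 s.2 (by simp)
    have hr : β.lt r.2 p.2 := by
      rcases (lex_cons_iff (prod α β)).1 h with (h | ⟨h, -⟩) | ⟨h, -⟩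
      · exact β.trans h hs
      · rwa [h]
      · rwa [h]
    rw [List.map_cons]
    refine List.pairwise_cons.2 ⟨?_, hl⟩
    intro c hc
    rw [List.map_cons, List.mem_cons] at hc
    rcases hc with rfl | hc
    · exact hr
    · rw [List.map_cons] at hl
      exact β.trans ((List.pairwise_cons.1 hl).1 c hc) hr

theorem decrList_ext (α : ExtOrd.{u}) (β : ExtOrd.{v}) :
    ∀ (l m : DecrList α β), (∀ z, DecrList.lt α β z l ↔ DecrList.lt α β z m) → l = m := by
  have key : ∀ (p q : α.carrier × β.carrier) (l m : List (α.carrier × β.carrier)) hl hm,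
      (∀ z, DecrList.lt α β z ⟨p :: l, hl⟩ ↔ DecrList.lt α β z ⟨q :: m, hm⟩) →
      ∀ r, (prod α β).lt r p → (prod α β).lt r q := by
    intro p q l m hl hm h r hr
    have h1 := (h ⟨[r], List.pairwise_singleton _ _⟩).1 (List.Lex.rel hr)
    rcases (lex_cons_iff (prod α β)).1 h1 with h1 | ⟨rfl, -⟩
    · exact h1
    · have h2 := (h ⟨r :: m, hm⟩).1 (List.Lex.rel hr)
      exact (lex_irrefl (prod α β) _ h2).elim
  rintro ⟨l, hl⟩
  induction l with
  | nil =>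
    rintro ⟨m, hm⟩ h
    cases m with
    | nil => rfl
    | cons q m => exact nomatch (h ⟨[], hl⟩).2 List.Lex.nil
  | cons p l ih =>
    rintro ⟨m, hm⟩ h
    cases m with
    | nil => exact nomatch (h ⟨[], hm⟩).1 List.Lex.nil
    | cons q m =>
      have hpq : p = q := (prod α β).ext fun r =>
        ⟨key p q l m hl hm h r, key q p m l hm hl (fun z => (h z).symm) r⟩
      subst hpq
      have tail : ∀ (l m : List (α.carrier × β.carrier)) hl hm,
          (∀ z, DecrList.lt α β z ⟨p :: l, hl⟩ ↔ DecrList.lt α β z ⟨p :: m, hm⟩) →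
          ∀ z : DecrList α β, List.Lex (prod α β).lt z.1 l → List.Lex (prod α β).lt z.1 m := by
        intro l m hl hm h z hz
        have h1 := (h ⟨p :: z.1, decr_cons_of_lex hl z.2 hz⟩).1 (List.Lex.cons hz)
        rcases (lex_cons_iff (prod α β)).1 h1 with h1 | ⟨-, h1⟩
        · exact ((prod α β).lt_irrefl _ h1).elim
        · exact h1
      have hl' : (l.map Prod.snd).Pairwise fun b c => β.lt c b := (List.pairwise_cons.1 hl).2
      have hm' : (m.map Prod.snd).Pairwise fun b c => β.lt c b := (List.pairwise_cons.1 hm).2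
      have := ih hl' ⟨m, hm'⟩ fun z =>
        ⟨tail l m hl hm h z, tail m l hm hl (fun z => (h z).symm) z⟩
      have hlm : l = m := congrArg Subtype.val this
      subst hlm
      rfl

theorem decrList_wf (α : ExtOrd.{u}) (β : ExtOrd.{v}) : WellFounded (DecrList.lt α β) := by
  have hnil : ∀ h, Acc (DecrList.lt α β) ⟨[], h⟩ :=
    fun _ => ⟨_, fun z hz => (not_lex_nil (prod α β) z.1 hz).elim⟩
  have hcons : ∀ (p : α.carrier × β.carrier) (l : DecrList α β), Acc (DecrList.lt α β) l →
      ∀ h, Acc (DecrList.lt α β) ⟨p :: l.1, h⟩ := by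
    intro p
    induction p using (prod α β).wf.induction with
    | _ p ih =>
      have below : ∀ (q : α.carrier × β.carrier) (m : List (α.carrier × β.carrier)) h,
          (prod α β).lt q p → Acc (DecrList.lt α β) ⟨q :: m, h⟩ := by
        intro q m
        induction m generalizing q with
        | nil => exact fun h hq => ih q hq ⟨[], by simp⟩ (hnil _) h
        | cons r m ihm =>
          intro h hq
          have hr : (prod α β).lt r q := Or.inl ((List.pairwise_cons.1 h).1 r.2 (by simp))
          have h' : ((r :: m).map Prod.snd).Pairwise fun b c => β.lt c b :=
            (List.pairwise_cons.1 h).2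
          exact ih q hq ⟨r :: m, h'⟩ (ihm r h' ((prod α β).trans hr hq)) h
      intro l hl
      induction hl with
      | intro l _ ihl =>
        intro h
        refine ⟨_, ?_⟩
        rintro ⟨m, hm⟩ hlt
        cases m with
        | nil => exact hnil hm
        | cons q m =>
          rcases (lex_cons_iff (prod α β)).1 hlt with hq | ⟨rfl, hq⟩
          · exact below q m hm hq
          · exact ihl ⟨m, (List.pairwise_cons.1 hm).2⟩ hq hm
  refine ⟨?_⟩
  rintro ⟨l, hl⟩
  induction l with
  | nil => exact hnil hl
  | cons p l ih => exact hcons p ⟨l, (List.pairwise_cons.1 hl).2⟩ (ih _) hl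

/-- Decreasing lists over `α × β` with the lexicographic order form an ordinal. -/
def decrListOrd (α : ExtOrd.{u}) (β : ExtOrd.{v}) : ExtOrd.{max u v} where
  carrier := DecrList α β
  lt := DecrList.lt α β
  trans := fun h₁ h₂ => lex_trans (prod α β) h₁ h₂
  ext := fun {l m} h => decrList_ext α β l m h
  wf := decrList_wf α β

/-- `bot` is a trichotomous least element of `α`: it is least, i.e. everything below `bot` is below
every element, and every `x` satisfies `x = bot` or `bot < x`. -/
structure IsTrichotomousLeast (α : ExtOrd.{u}) (bot : α.carrier) : Prop where
  least : ∀ a u : α.carrier, α.lt u bot → α.lt u a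
  trichotomous : ∀ x : α.carrier, x = bot ∨ α.lt bot x

/-- The ordinal of the elements of `α` above its trichotomous least element `bot`, with the
inherited order. -/
def above (α : ExtOrd.{u}) (bot : α.carrier) (h : IsTrichotomousLeast α bot) : ExtOrd.{u} where
  carrier := {a : α.carrier // α.lt bot a}
  lt := fun x y => α.lt x.1 y.1
  trans := fun h₁ h₂ => α.trans h₁ h₂
  ext := by
    intro x y hxy
    apply Subtype.ext
    apply α.ext
    intro z
    rcases h.trichotomous z with rfl | hz
    · exact ⟨fun _ => y.2, fun _ => x.2⟩
    · exact hxy ⟨z, hz⟩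
  wf := InvImage.wf Subtype.val α.wf

/-- Concrete exponentiation: the ordinal of decreasing lists over the elements of `α` above the
trichotomous least element `bot`, paired with elements of `β`. -/
def concreteExp (α : ExtOrd.{u}) (bot : α.carrier) (h : IsTrichotomousLeast α bot)
    (β : ExtOrd.{v}) : ExtOrd.{max u v} :=
  decrListOrd (above α bot h) β

end ExtOrd

/-!
The proof is by transfinite induction on the exponent `β`. Two ordinals are equivalent as soon as
each initial segment of one is equivalent to an initial segment of the other
(`ExtOrd.equivalent_of_init_below`), so it suffices to compare initial segments, and these are
transported along *simulations*: order preserving maps whose image is downward closed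
(`ExtOrd.IsSimulation.equivalent_init`).

Two families of simulations are used. The canonical maps `F i → sup F` are simulations
(`ExtOrd.isSimulation_supMk`), so the initial segments of `α ^ β` are those of `1` and of the
ordinals `α ^ (β ↓ b) × α`; by the induction hypothesis, the latter are equivalent to
`exp (α, β ↓ b) × α`. On the other side, decreasing lists over `β ↓ b` together with an element of
`α` give decreasing lists over `β`: send `(l, bot)` to `l`, and `(l, a)` with `bot < a` to
`(a, b) :: l`. This is a simulation `exp (α, β ↓ b) × α → exp (α, β)`
(`ExtOrd.isSimulation_consInit`). Every nonempty list `(a, b) :: l` is in its image for the right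
`b`, and the empty list corresponds to the unique element of `1`, so both sides have the same
initial segments.
-/

namespace ExtOrd

/-! ### Simulations -/

/-- A simulation: an order preserving map whose image is downward closed, in the sense that
everything below `f x` is the image of some element below `x`. -/
structure IsSimulation (γ : ExtOrd.{u}) (δ : ExtOrd.{v}) (f : γ.carrier → δ.carrier) : Prop where
  mono : ∀ {x y}, γ.lt x y → δ.lt (f x) (f y)
  lift : ∀ {x y}, δ.lt y (f x) → ∃ x', γ.lt x' x ∧ f x' = y

theorem IsSimulation.equivalent_init {γ : ExtOrd.{u}} {δ : ExtOrd.{v}}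
    {f : γ.carrier → δ.carrier} (hf : IsSimulation γ δ f) (x : γ.carrier) :
    Equivalent (γ.init x) (δ.init (f x)) := by
  induction x using γ.wf.induction with
  | _ x ih =>
    apply equivalent_of_init_below
    · intro y
      exact Below.congr_left ((init_init γ x y).trans (ih y.1 y.2))
        (init_below_init δ (hf.mono y.2))
    · intro y
      obtain ⟨x', hx', hy⟩ := hf.lift y.2
      have e := (ih x' hx').symm
      rw [hy] at e
      exact Below.congr_left ((init_init δ _ y).trans e) (init_below_init γ hx')

/-- The canonical map from a member of a family of ordinals to its supremum. -/
def supMk {I : Type v} (F : I → ExtOrd.{u}) (i : I) (x : (F i).carrier) : (sup F).carrier :=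
  Quotient.mk (supSetoid F) ⟨i, x⟩

theorem isSimulation_supMk {I : Type v} (F : I → ExtOrd.{u}) (i : I) :
    IsSimulation (F i) (sup F) (supMk F i) where
  mono h := init_below_init (F i) h
  lift := by
    rintro x ⟨j, z⟩ h
    obtain ⟨c, hc, e⟩ := below_init (β := F i) (b := x) h
    exact ⟨c, hc, Quotient.sound (s := supSetoid F) e.symm⟩

/-- A supremum is equivalent to `δ` if the members of the family and `δ` have the same initial
segments. -/
theorem sup_equivalent {I : Type v} {F : I → ExtOrd.{u}} {δ : ExtOrd.{w}}
    (h₁ : ∀ i x, Below ((F i).init x) δ)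
    (h₂ : ∀ y, ∃ i x, Equivalent ((F i).init x) (δ.init y)) : Equivalent (sup F) δ := by
  apply equivalent_of_init_below
  · rintro ⟨i, x⟩
    exact Below.congr_left ((isSimulation_supMk F i).equivalent_init x).symm (h₁ i x)
  · intro y
    obtain ⟨i, x, e⟩ := h₂ y
    exact ⟨supMk F i x, e.symm.trans ((isSimulation_supMk F i).equivalent_init x)⟩

theorem init_equivalent_of_isEmpty {γ : ExtOrd.{u}} {δ : ExtOrd.{v}} {x : γ.carrier}
    {y : δ.carrier} (hx : ∀ z, ¬ γ.lt z x) (hy : ∀ z, ¬ δ.lt z y) :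
    Equivalent (γ.init x) (δ.init y) :=
  equivalent_of_init_below (fun a => (hx _ a.2).elim) (fun b => (hy _ b.2).elim)

theorem Equivalent.prod_right {γ : ExtOrd.{u}} {δ : ExtOrd.{v}} (h : Equivalent γ δ)
    (α : ExtOrd.{w}) : Equivalent (prod γ α) (prod δ α) := by
  obtain ⟨e⟩ := h
  exact ⟨{ toEquiv := e.toEquiv.prodCongr (Equiv.refl _)
           map_rel_iff' := fun {p q} =>
             or_congr Iff.rfl (and_congr Iff.rfl (e.map_rel_iff (a := p.1) (b := q.1))) }⟩

/-! ### Decreasing lists over an initial segment -/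

/-- The inclusion of `α × (β ↓ b)` into `α × β`. -/
def inclEntry {α : ExtOrd.{u}} {β : ExtOrd.{v}} {b : β.carrier}
    (p : α.carrier × (β.init b).carrier) : α.carrier × β.carrier :=
  (p.1, p.2.1)

theorem inclEntry_injective {α : ExtOrd.{u}} {β : ExtOrd.{v}} {b : β.carrier} :
    Function.Injective (inclEntry : α.carrier × (β.init b).carrier → _) := fun _ _ h =>
  Prod.ext (Prod.mk.inj h).1 (Subtype.ext (Prod.mk.inj h).2)

/-- The inclusion of decreasing lists over `α × (β ↓ b)` into those over `α × β`. -/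
def DecrList.incl {α : ExtOrd.{u}} {β : ExtOrd.{v}} {b : β.carrier}
    (l : DecrList α (β.init b)) : DecrList α β :=
  ⟨l.1.map inclEntry, List.pairwise_map.2 (List.pairwise_map.2 (List.pairwise_map.1 l.2))⟩

theorem DecrList.pairwise_cons_incl {α : ExtOrd.{u}} {β : ExtOrd.{v}} {b : β.carrier}
    (a : α.carrier) (l : DecrList α (β.init b)) :
    (((a, b) :: l.incl.1).map Prod.snd).Pairwise fun b c => β.lt c b := by
  rw [List.map_cons]
  refine List.pairwise_cons.2 ⟨?_, l.incl.2⟩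
  intro c hc
  obtain ⟨q, hq, rfl⟩ := List.mem_map.1 hc
  obtain ⟨p, -, rfl⟩ := List.mem_map.1 hq
  exact p.2.2

/-- A list that can be extended by `b` is a list over `α × (β ↓ b)`. -/
theorem DecrList.exists_incl_eq {α : ExtOrd.{u}} {β : ExtOrd.{v}} {b : β.carrier}
    {a : α.carrier} {m : List (α.carrier × β.carrier)}
    (h : (((a, b) :: m).map Prod.snd).Pairwise fun b c => β.lt c b) :
    ∃ l : DecrList α (β.init b), l.incl.1 = m := by
  rw [List.map_cons, List.pairwise_cons] at h
  have hm : ∀ p ∈ m, β.lt p.2 b := fun p hp => h.1 p.2 (List.mem_map_of_mem hp)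
  refine ⟨⟨m.attach.map fun p => (p.1.1, ⟨p.1.2, hm p.1 p.2⟩), ?_⟩, ?_⟩
  · have h2 := h.2
    rw [← m.attach_map_subtype_val] at h2
    simp only [List.pairwise_map] at h2 ⊢
    exact h2
  · exact List.map_map.trans m.attach_map_subtype_val

theorem DecrList.incl_lt_iff {α : ExtOrd.{u}} {β : ExtOrd.{v}} {b : β.carrier} :
    ∀ {l m : DecrList α (β.init b)},
      DecrList.lt α β l.incl m.incl ↔ DecrList.lt α (β.init b) l m := by
  have key : ∀ l m : List (α.carrier × (β.init b).carrier),
      List.Lex (prod α β).lt (l.map inclEntry) (m.map inclEntry) ↔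
        List.Lex (prod α (β.init b)).lt l m := by
    intro l
    induction l with
    | nil =>
      rintro (_ | ⟨q, m⟩)
      · exact Iff.intro (fun h => nomatch h) (fun h => nomatch h)
      · exact ⟨fun _ => List.Lex.nil, fun _ => List.Lex.nil⟩
    | cons p l ih =>
      rintro (_ | ⟨q, m⟩)
      · exact Iff.intro (fun h => nomatch h) (fun h => nomatch h)
      · refine (lex_cons_iff (prod α β)).trans
          (Iff.trans ?_ (lex_cons_iff (prod α (β.init b))).symm)
        exact or_congr
          (or_congr Iff.rfl (and_congr Subtype.val_injective.eq_iff Iff.rfl))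
          (and_congr inclEntry_injective.eq_iff (ih m))
  exact fun {l m} => key l.1 m.1

/-- The lists over `α × (β ↓ b)` are downward closed among the lists over `α × β`. -/
theorem DecrList.exists_incl_eq_of_lt {α : ExtOrd.{u}} {β : ExtOrd.{v}} {b : β.carrier}
    {m : DecrList α β} {l : DecrList α (β.init b)} (h : DecrList.lt α β m l.incl) :
    ∃ k : DecrList α (β.init b), DecrList.lt α (β.init b) k l ∧ k.incl = m := by
  obtain ⟨k, hk⟩ : ∃ k : DecrList α (β.init b), k.incl.1 = m.1 := by
    obtain ⟨m, hm⟩ := m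
    cases m with
    | nil => exact ⟨⟨[], List.Pairwise.nil⟩, rfl⟩
    | cons q m =>
      -- Any list below `l` may be extended by `b`, since `l` itself may.
      exact exists_incl_eq (decr_cons_of_lex (pairwise_cons_incl q.1 l) hm h)
  obtain rfl : k.incl = m := Subtype.ext hk
  exact ⟨k, incl_lt_iff.1 h, rfl⟩

/-! ### Concrete exponentials over initial segments -/

theorem IsTrichotomousLeast.not_lt {α : ExtOrd.{u}} {bot : α.carrier}
    (h : IsTrichotomousLeast α bot) (a : α.carrier) : ¬ α.lt a bot :=
  fun ha => α.lt_irrefl a (h.least a a ha)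

section

variable {α : ExtOrd.{u}} {β : ExtOrd.{v}} {bot : α.carrier} (h : IsTrichotomousLeast α bot)

open Classical in
/-- The map `exp (α, β ↓ b) × α → exp (α, β)` that sends `(l, bot)` to `l`, and `(l, a)` with
`bot < a` to `(a, b) :: l`. -/
noncomputable def consInit (b : β.carrier)
    (p : (prod (concreteExp α bot h (β.init b)) α).carrier) :
    (concreteExp α bot h β).carrier :=
  if hp : α.lt bot p.2 then
    ⟨(⟨p.2, hp⟩, b) :: (DecrList.incl p.1).1, DecrList.pairwise_cons_incl _ _⟩
  else DecrList.incl p.1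

theorem consInit_bot (b : β.carrier) (l : (concreteExp α bot h (β.init b)).carrier) :
    consInit h b (l, bot) = DecrList.incl l :=
  dif_neg (α.lt_irrefl bot)

theorem consInit_of_lt (b : β.carrier) (l : (concreteExp α bot h (β.init b)).carrier)
    (a : (above α bot h).carrier) :
    consInit h b (l, a.1) =
      ⟨(a, b) :: (DecrList.incl l).1, DecrList.pairwise_cons_incl _ _⟩ :=
  dif_pos a.2

theorem isSimulation_consInit (b : β.carrier) :
    IsSimulation (prod (concreteExp α bot h (β.init b)) α) (concreteExp α bot h β)
      (consInit h b) where
  mono := by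
    rintro ⟨l', a'⟩ ⟨l, a⟩ hlt
    rcases h.trichotomous a with rfl | ha
    · rcases hlt with hlt | ⟨heq, hlt⟩
      · exact (h.not_lt _ hlt).elim
      · dsimp only at heq
        subst heq
        rw [consInit_bot, consInit_bot]
        exact DecrList.incl_lt_iff.2 hlt
    · rw [consInit_of_lt h b l ⟨a, ha⟩]
      rcases hlt with hlt | ⟨heq, hlt⟩
      · rcases h.trichotomous a' with rfl | ha'
        · rw [consInit_bot]
          obtain ⟨_ | ⟨q, l'⟩, hl'⟩ := l'
          · exact List.Lex.nil
          · exact List.Lex.rel (Or.inl q.2.2)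
        · rw [consInit_of_lt h b l' ⟨a', ha'⟩]
          exact List.Lex.rel (Or.inr ⟨rfl, hlt⟩)
      · dsimp only at heq
        subst heq
        rw [consInit_of_lt h b l' ⟨a', ha⟩]
        exact List.Lex.cons (DecrList.incl_lt_iff.2 hlt)
  lift := by
    rintro ⟨l, a⟩ ⟨m, hm⟩ hlt
    rcases h.trichotomous a with rfl | ha
    · rw [consInit_bot] at hlt
      obtain ⟨k, hk, e⟩ := DecrList.exists_incl_eq_of_lt hlt
      exact ⟨(k, a), Or.inr ⟨rfl, hk⟩, (consInit_bot h b k).trans e⟩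
    · rw [consInit_of_lt h b l ⟨a, ha⟩] at hlt
      cases m with
      | nil =>
        exact ⟨(⟨[], List.Pairwise.nil⟩, bot), Or.inl ha, consInit_bot h b _⟩
      | cons q m =>
        obtain ⟨a', b'⟩ := q
        rcases (lex_cons_iff (prod (above α bot h) β)).1 hlt with (hb | ⟨hb, ha'⟩) | ⟨he, hml⟩
        · -- The list starts below `b`, so it is a list over `β ↓ b` and comes from `bot`.
          obtain ⟨k, hk⟩ : ∃ k : DecrList (above α bot h) (β.init b),
              k.incl.1 = (a', b') :: m := by
            refine DecrList.exists_incl_eq (a := a') ?_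
            rw [List.map_cons]
            refine List.pairwise_cons.2 ⟨?_, hm⟩
            intro c hc
            rw [List.map_cons, List.mem_cons] at hc
            rcases hc with rfl | hc
            · exact hb
            · exact β.trans ((List.pairwise_cons.1 hm).1 c hc) hb
          exact ⟨(k, bot), Or.inl ha, (consInit_bot h b k).trans (Subtype.ext hk)⟩
        · dsimp only at hb
          subst hb
          obtain ⟨k, rfl⟩ := DecrList.exists_incl_eq hm
          exact ⟨(k, a'.1), Or.inl ha', consInit_of_lt h _ k a'⟩
        · obtain ⟨rfl, rfl⟩ := Prod.mk.inj he
          obtain ⟨k, rfl⟩ := DecrList.exists_incl_eq hm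
          exact ⟨(k, a), Or.inr ⟨rfl, DecrList.incl_lt_iff.1 hml⟩,
            consInit_of_lt h _ k ⟨a, ha⟩⟩

/-- A list is empty or in the image of `consInit h b`, where `b` is the `β`-component of its
first entry. -/
theorem eq_nil_or_exists_consInit (l : (concreteExp α bot h β).carrier) :
    l = ⟨[], List.Pairwise.nil⟩ ∨ ∃ b p, consInit h b p = l := by
  obtain ⟨_ | ⟨⟨a, b⟩, m⟩, hl⟩ := l
  · exact Or.inl rfl
  · obtain ⟨k, rfl⟩ := DecrList.exists_incl_eq hl
    exact Or.inr ⟨b, (k, a.1), consInit_of_lt h b k a⟩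

end

end ExtOrd

theorem theorem28 (α : ExtOrd.{u}) (β : ExtOrd.{v}) (bot : α.carrier)
    (h : ExtOrd.IsTrichotomousLeast α bot) :
    ExtOrd.Equivalent (ExtOrd.abstractExp.{u, v} α β) (ExtOrd.concreteExp α bot h β) := by
  open ExtOrd in
  induction β using below_wf.induction with
  | _ β ih =>
    have hnil : ∀ x : one.carrier, Equivalent (one.init x)
        ((concreteExp α bot h β).init ⟨[], List.Pairwise.nil⟩) := fun x =>
      init_equivalent_of_isEmpty (fun _ hz => hz)
        (fun z hz => not_lex_nil (prod (above α bot h) β) z.1 hz)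
    have hprod : ∀ b, Equivalent (prod (abstractExp.{u, v} α (β.init b)) α)
        (prod (concreteExp α bot h (β.init b)) α) := fun b =>
      (ih _ (init_below β b)).prod_right α
    rw [abstractExp_eq]
    apply sup_equivalent
    · rintro (_ | b) x
      · exact ⟨_, hnil x⟩
      · obtain ⟨e⟩ := hprod b
        exact ⟨_, (equivalent_init e x).trans ((isSimulation_consInit h b).equivalent_init (e x))⟩
    · intro y
      rcases eq_nil_or_exists_consInit h y with rfl | ⟨b, p, rfl⟩
      · exact ⟨Sum.inl PUnit.unit, PUnit.unit, hnil _⟩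
      · obtain ⟨e⟩ := (hprod b).symm
        exact ⟨Sum.inr b, e p,
          (equivalent_init e p).symm.trans ((isSimulation_consInit h b).equivalent_init p)⟩
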